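/- Let $R=\mathbb{K}[x_1,\dots,x_n]$ be a standard graded polynomial ring over a field $\mathbb{K}$, let $\Lambda$ be a finite poset and let $\{u_\lambda:\lambda\in\Lambda\}\subseteq R$ be a family of homogeneous elements, not all zero. For $\Sigma\subseteq\Lambda$ write $U_\Sigma$ for the ideal generated by $\{u_\sigma:\sigma\in\Sigma\}$. A poset ideal is a subset $\Sigma\subseteq\Lambda$ such that $\lambda\le\sigma\in\Sigma$ implies $\lambda\in\Sigma$; an element $\lambda\in\Lambda$ lies just above $\Sigma$ if $\lambda\notin\Sigma$ and every $\sigma<\lambda$ is in $\Sigma$; and $\lambda$ lies inside or just above $\Sigma$ if $\lambda\in\Sigma$ or $\lambda$ lies just above $\Sigma$. Suppose that $\{u_\lambda\}$ is a quadratic sequence, that is, for every poset ideal $\Sigma$ and every $\lambda$ lying inside or just above $\Sigma$ there is a poset ideal $\Theta$ of $\Lambda$ with $$(U_\Sigma:u_\lambda)\cap U_\Lambda\subseteq U_\Theta\quad\text{and}\quad u_\lambda U_\Theta\subseteq U_\Sigma U_\Lambda .$$ Let $d=\max\{\deg u_\lambda:\lambda\in\Lambda,\ u_\lambda\neq0\}$.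 Then for every $s\ge1$, $$\operatorname{reg}(R/U_\Lambda^s)\le d(s-1)+\max_{(\Sigma,\lambda)}\operatorname{reg}\bigl(R/((U_\Sigma:u_\lambda)+U_\Lambda)\bigr),$$ where the maximum runs over all pairs $(\Sigma,\lambda)$ with $\Sigma$ a poset ideal of $\Lambda$ and $\lambda\in\Lambda$ lying inside or just above $\Sigma$. Here $\operatorname{reg}(M)=\max\{j-i:\operatorname{Tor}^R_i(M,\mathbb{K})_j\ne0\}$ is the Castelnuovo–Mumford regularity, with $\operatorname{reg}(0)=-\infty$. -/

import Mathlib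

open MvPolynomial

noncomputable section

namespace QuadraticSequence

section Regularity

variable {K : Type*} [Field K] {M : Type*} [AddCommGroup M] [Module K M]

/-- The differential of the Koszul complex of the variables `x_1, …, x_n` with coefficients in the
module `M` over the polynomial ring. A chain `f` stands for `∑ S, f S ⊗ e_S`, where `e_S` is the
basis element `e_{s_1} ∧ ⋯ ∧ e_{s_i}` for `S = {s_1 < ⋯ < s_i}`, and the differential sends `m ⊗ e_S`
to `∑ k, (-1)^(k-1) x_{s_k} m ⊗ e_{S ∖ {s_k}}`. -/
def koszulDiff (K : Type*) [Field K] (n : ℕ) (M : Type*) [AddCommGroup M]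
    [Module (MvPolynomial (Fin n) K) M] :
    (Finset (Fin n) → M) →ₗ[MvPolynomial (Fin n) K] (Finset (Fin n) → M) :=
  LinearMap.pi fun T => ∑ v ∈ Tᶜ,
    ((-1 : MvPolynomial (Fin n) K) ^ (T.filter (· < v)).card * X v) •
      (LinearMap.proj (insert v T) :
        (Finset (Fin n) → M) →ₗ[MvPolynomial (Fin n) K] M)

/-- Koszul chains of homological degree `i` and internal degree `j` (`e_S` has internal degree
`|S|`), for a module `M` with homogeneous components `ℳ j`. -/
def koszulChains (n : ℕ) (ℳ : ℤ → Submodule K M) (i : ℕ) (j : ℤ) :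
    Submodule K (Finset (Fin n) → M) :=
  Submodule.pi Set.univ fun S => if S.card = i then ℳ (j - i) else ⊥

/-- Koszul cycles of homological degree `i` and internal degree `j`. -/
def koszulCycles (n : ℕ) [Module (MvPolynomial (Fin n) K) M]
    [IsScalarTower K (MvPolynomial (Fin n) K) M] (ℳ : ℤ → Submodule K M) (i : ℕ) (j : ℤ) :
    Submodule K (Finset (Fin n) → M) :=
  koszulChains n ℳ i j ⊓ LinearMap.ker ((koszulDiff K n M).restrictScalars K)

/-- Koszul boundaries of homological degree `i` and internal degree `j`. -/
def koszulBoundaries (n : ℕ) [Module (MvPolynomial (Fin n) K) M]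
    [IsScalarTower K (MvPolynomial (Fin n) K) M] (ℳ : ℤ → Submodule K M) (i : ℕ) (j : ℤ) :
    Submodule K (Finset (Fin n) → M) :=
  (koszulChains n ℳ (i + 1) j).map ((koszulDiff K n M).restrictScalars K)

/-- `Tor_i(M, K)_j`, the component of internal degree `j` of `Tor_i` over `K[x_1, …, x_n]` of a
graded module `M` with the residue field `K`, computed by the Koszul resolution of `K`: cycles
modulo boundaries. Its dimension over `K` is the graded Betti number `β_{i,j}(M)`. -/
abbrev GradedTor (n : ℕ) [Module (MvPolynomial (Fin n) K) M]
    [IsScalarTower K (MvPolynomial (Fin n) K) M] (ℳ : ℤ → Submodule K M) (i : ℕ) (j : ℤ) : Type _ :=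
  ↥(koszulCycles n ℳ i j) ⧸ (koszulBoundaries n ℳ i j).submoduleOf (koszulCycles n ℳ i j)

/-- Castelnuovo-Mumford regularity `sup {j - i | Tor_i(M, K)_j ≠ 0}` of a graded module over
`K[x_1, …, x_n]`. It is `-∞` for the zero module. -/
def regularity (n : ℕ) [Module (MvPolynomial (Fin n) K) M]
    [IsScalarTower K (MvPolynomial (Fin n) K) M] (ℳ : ℤ → Submodule K M) : EReal :=
  ⨆ (i : ℕ) (j : ℤ) (_ : Nontrivial (GradedTor n ℳ i j)), (((j - i : ℤ) : ℝ) : EReal)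

/-- The grading of `R ⧸ I` induced by the standard grading of `R = K[x_1, …, x_n]`. -/
def quotientGrading {n : ℕ} (I : Ideal (MvPolynomial (Fin n) K)) (j : ℤ) :
    Submodule K (MvPolynomial (Fin n) K ⧸ I) :=
  if 0 ≤ j then
    (homogeneousSubmodule (Fin n) K j.toNat).map (Ideal.Quotient.mkₐ K I).toLinearMap
  else ⊥

/-- The regularity of `R ⧸ I` for a homogeneous ideal `I` of `R = K[x_1, …, x_n]`. -/
def regQuot {n : ℕ} (I : Ideal (MvPolynomial (Fin n) K)) : EReal :=
  regularity n (quotientGrading I)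

end Regularity

section Sequences

variable {R : Type*} [CommRing R] {L : Type*} [PartialOrder L]

/-- The ideal `U_Σ` generated by the elements `u l` with `l ∈ Σ`. -/
def idealOf (u : L → R) (S : Set L) : Ideal R := Ideal.span (u '' S)

/-- `l` lies just above the poset ideal `S`. -/
def LiesJustAbove (S : LowerSet L) (l : L) : Prop :=
  l ∉ S ∧ ∀ m : L, m < l → m ∈ S

/-- `l` lies inside or just above the poset ideal `S`. -/
def LiesInsideOrJustAbove (S : LowerSet L) (l : L) : Prop :=
  l ∈ S ∨ LiesJustAbove S l

/-- Quadratic sequences (with respect to the zero ideal). -/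
def IsQuadraticSequence (u : L → R) : Prop :=
  ∀ (S : LowerSet L) (l : L), LiesInsideOrJustAbove S l →
    ∃ T : LowerSet L,
      (idealOf u S).colon {u l} ⊓ idealOf u Set.univ ≤ idealOf u T ∧
      Ideal.span {u l} * idealOf u T ≤ idealOf u S * idealOf u Set.univ

end Sequences

end QuadraticSequence

end

/-! Write `I` for the ideal of the whole sequence. Each layer `I ^ (k+1) / I ^ (k+2)` is filtered by
the images of `U_S * I ^ k`, with `S` growing one poset element at a time. When `l` lies just above
`S`, multiplication by `u l` identifies the new factor with `I ^ k / ((powStage u k S : u l) ⊓ I ^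
k)`, shifted by `deg (u l) ≤ d`.

The quadratic condition identifies that denominator. It yields `U_S ⊓ I ^ (k+1) = U_S * I ^ k`
(`idealOf_inf_pow`). Hence for `k = 0` the factor is `R / ((U_S : u l) + I)`, one of the quotients
in the maximum (`colon_powStage_zero`), while at level `k + 1` the denominator is again a stage, at
level `k` (`exists_colon_powStage_succ`). Induction bounds `reg (I ^ (k+1) / I ^ (k+2))` by `(k+1) *
d` plus the maximum, and gluing the layers onto `R / I` gives the theorem.

Regularity is handled as vanishing of Koszul homology of subquotients `A / B`, expressed by chains
in `R` itself. -/

open MvPolynomial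

attribute [local instance] MvPolynomial.gradedAlgebra

namespace QuadraticSequence

/-! ### Graded Koszul homology of subquotients of the polynomial ring -/

section Koszul

variable {K : Type*} [Field K] {n : ℕ}

theorem koszulDiff_apply {M : Type*} [AddCommGroup M] [Module (MvPolynomial (Fin n) K) M]
    (f : Finset (Fin n) → M) (T : Finset (Fin n)) :
    koszulDiff K n M f T = ∑ v ∈ Tᶜ,
      ((-1 : MvPolynomial (Fin n) K) ^ (T.filter (· < v)).card * X v) • f (insert v T) := by
  simp [koszulDiff, LinearMap.pi_apply, LinearMap.sum_apply]

theorem koszulDiff_comp {M N : Type*} [AddCommGroup M] [Module (MvPolynomial (Fin n) K) M]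
    [AddCommGroup N] [Module (MvPolynomial (Fin n) K) N]
    (φ : M →ₗ[MvPolynomial (Fin n) K] N) (f : Finset (Fin n) → M) (T : Finset (Fin n)) :
    koszulDiff K n N (fun S => φ (f S)) T = φ (koszulDiff K n M f T) := by
  simp only [koszulDiff_apply, map_sum, map_smul]

theorem card_filter_insert_lt {T : Finset (Fin n)} {v w : Fin n} (hv : v ∉ T) (h : v < w) :
    ((insert v T).filter (· < w)).card = (T.filter (· < w)).card + 1 := by
  rw [Finset.filter_insert, if_pos h, Finset.card_insert_of_notMem (by simp [hv])]

theorem card_filter_insert_gt {T : Finset (Fin n)} {v w : Fin n} (h : v < w) :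
    ((insert w T).filter (· < v)).card = (T.filter (· < v)).card := by
  rw [Finset.filter_insert, if_neg h.not_gt]

theorem koszulDiff_koszulDiff {M : Type*} [AddCommGroup M] [Module (MvPolynomial (Fin n) K) M]
    (f : Finset (Fin n) → M) : koszulDiff K n M (koszulDiff K n M f) = 0 := by
  funext T
  simp only [koszulDiff_apply, Finset.smul_sum, Pi.zero_apply]
  rw [Finset.sum_sigma']
  -- The two orders of inserting `v < w` carry opposite signs: only inserting the smaller index
  -- first changes the other's sign count.
  have key : ∀ v w : Fin n, v ∉ T → w ∉ T → v < w →
      ((-1 : MvPolynomial (Fin n) K) ^ (T.filter (· < v)).card * X v) •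
        ((-1 : MvPolynomial (Fin n) K) ^ ((insert v T).filter (· < w)).card * X w) •
          f (insert w (insert v T)) +
      ((-1 : MvPolynomial (Fin n) K) ^ (T.filter (· < w)).card * X w) •
        ((-1 : MvPolynomial (Fin n) K) ^ ((insert w T).filter (· < v)).card * X v) •
          f (insert v (insert w T)) = 0 := by
    intro v w hv hw h
    rw [card_filter_insert_lt hv h, card_filter_insert_gt h, Finset.insert_comm v w, smul_smul,
      smul_smul, ← add_smul]
    rw [pow_succ, ← zero_smul (MvPolynomial (Fin n) K) (f (insert w (insert v T)))]
    congr 1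
    ring
  refine Finset.sum_involution (fun p _ => ⟨p.2, p.1⟩) ?_ ?_ ?_ ?_
  · rintro ⟨v, w⟩ h
    simp only [Finset.mem_sigma, Finset.mem_compl, Finset.mem_insert, not_or] at h
    obtain ⟨hv, hwv, hw⟩ := h
    rcases lt_or_gt_of_ne hwv with h | h
    · rw [add_comm]
      exact key w v hw hv h
    · exact key v w hv hw h
  · rintro ⟨v, w⟩ h _ e
    simp only [Finset.mem_sigma, Finset.mem_compl, Finset.mem_insert, not_or] at h
    simp only [Sigma.mk.injEq] at e
    exact h.2.1 e.1
  · rintro ⟨v, w⟩ h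
    simp only [Finset.mem_sigma, Finset.mem_compl, Finset.mem_insert, not_or] at h ⊢
    exact ⟨h.2.2, fun e => h.2.1 e.symm, h.1⟩
  · rintro ⟨v, w⟩ _
    rfl

theorem koszulDiff_mem {f : Finset (Fin n) → MvPolynomial (Fin n) K}
    {A : Ideal (MvPolynomial (Fin n) K)} (h : ∀ S, f S ∈ A) (T : Finset (Fin n)) :
    koszulDiff K n _ f T ∈ A := by
  rw [koszulDiff_apply]
  exact A.sum_mem fun v _ => A.smul_mem _ (h _)

/-- The standard grading of the polynomial ring, indexed by the integers. -/
noncomputable def intGrading (K : Type*) [Field K] (n : ℕ) (e : ℤ) : Submodule K (MvPolynomial (Fin n) K) :=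
  if 0 ≤ e then homogeneousSubmodule (Fin n) K e.toNat else ⊥

theorem mem_intGrading_natCast {k : ℕ} {p : MvPolynomial (Fin n) K} :
    p ∈ intGrading K n k ↔ p.IsHomogeneous k := by
  simp [intGrading, mem_homogeneousSubmodule]

theorem intGrading_of_neg {e : ℤ} (he : e < 0) : intGrading K n e = ⊥ := by
  simp [intGrading, he]

theorem mul_mem_intGrading {k : ℕ} {e : ℤ} {p q : MvPolynomial (Fin n) K}
    (hp : p.IsHomogeneous k) (hq : q ∈ intGrading K n e) : p * q ∈ intGrading K n (e + k) := by
  rcases lt_or_ge e 0 with he | he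
  · rw [intGrading_of_neg he, Submodule.mem_bot] at hq
    simp [hq]
  · lift e to ℕ using he
    rw [mem_intGrading_natCast] at hq
    rw [add_comm, ← Nat.cast_add, mem_intGrading_natCast]
    exact hp.mul hq

theorem quotientGrading_eq_map (I : Ideal (MvPolynomial (Fin n) K)) (e : ℤ) :
    quotientGrading I e = (intGrading K n e).map (Ideal.Quotient.mkₐ K I).toLinearMap := by
  unfold quotientGrading intGrading
  split_ifs <;> simp

theorem mem_koszulChains {M : Type*} [AddCommGroup M] [Module K M] {ℳ : ℤ → Submodule K M}
    {i : ℕ} {j : ℤ} {f : Finset (Fin n) → M} :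
    f ∈ koszulChains n ℳ i j ↔
      (∀ S, S.card = i → f S ∈ ℳ (j - i)) ∧ ∀ S, S.card ≠ i → f S = 0 := by
  simp only [koszulChains, Submodule.mem_pi, Set.mem_univ, true_implies]
  refine ⟨fun h => ⟨fun S hS => by simpa [hS] using h S, fun S hS => by simpa [hS] using h S⟩,
    fun h S => ?_⟩
  split_ifs with hS
  · exact h.1 S hS
  · simpa using h.2 S hS

theorem koszulDiff_mem_koszulChains {f : Finset (Fin n) → MvPolynomial (Fin n) K} {i : ℕ} {j : ℤ}
    (hf : f ∈ koszulChains n (intGrading K n) (i + 1) j) :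
    koszulDiff K n _ f ∈ koszulChains n (intGrading K n) i j := by
  rw [mem_koszulChains] at hf ⊢
  refine ⟨fun T hT => ?_, fun T hT => ?_⟩
  · rw [koszulDiff_apply]
    refine Submodule.sum_mem _ fun v hv => ?_
    have hS : (insert v T).card = i + 1 := by
      rw [Finset.card_insert_of_notMem (Finset.mem_compl.1 hv), hT]
    have hs : ((-1 : MvPolynomial (Fin n) K) ^ (T.filter (· < v)).card * X v).IsHomogeneous 1 := by
      rcases neg_one_pow_eq_or (MvPolynomial (Fin n) K) (T.filter (· < v)).card with h | h
      · rw [h, one_mul]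
        exact isHomogeneous_X K v
      · rw [h, neg_one_mul]
        exact (isHomogeneous_X K v).neg
    have := mul_mem_intGrading hs (hf.1 _ hS)
    rw [smul_eq_mul]
    convert this using 2
    push_cast
    ring
  · rw [koszulDiff_apply]
    refine Finset.sum_eq_zero fun v hv => ?_
    rw [hf.2 _ (by rw [Finset.card_insert_of_notMem (Finset.mem_compl.1 hv)]; omega), smul_zero]

/-- Vanishing of the Koszul homology of `A / B` in homological degree `i` and internal degree `j`,
for ideals `B ≤ A` of the polynomial ring. -/
def KoszulExactAt (A B : Ideal (MvPolynomial (Fin n) K)) (i : ℕ) (j : ℤ) : Prop :=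
  ∀ z ∈ koszulChains n (intGrading K n) i j, (∀ S, z S ∈ A) → (∀ T, koszulDiff K n _ z T ∈ B) →
    ∃ w ∈ koszulChains n (intGrading K n) (i + 1) j, (∀ S, w S ∈ A) ∧
      ∀ S, z S - koszulDiff K n _ w S ∈ B

theorem KoszulExactAt.refl (A : Ideal (MvPolynomial (Fin n) K)) (i : ℕ) (j : ℤ) :
    KoszulExactAt A A i j := fun z _ hA _ =>
  ⟨0, Submodule.zero_mem _, fun _ => A.zero_mem, fun S => by simpa using hA S⟩

/-- Middle term of the long exact sequence of `0 → B/C → A/C → A/B → 0`: bound the cycle modulo `B`,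
then bound the remainder, a cycle of `B/C`. -/
theorem KoszulExactAt.trans {A B C : Ideal (MvPolynomial (Fin n) K)} {i : ℕ} {j : ℤ}
    (hBA : B ≤ A) (hCB : C ≤ B) (hAB : KoszulExactAt A B i j) (hBC : KoszulExactAt B C i j) :
    KoszulExactAt A C i j := by
  intro z hz hA hd
  obtain ⟨w, hw, hwA, hwB⟩ := hAB z hz hA fun T => hCB (hd T)
  obtain ⟨w', hw', hwB', hwC'⟩ := hBC (z - koszulDiff K n _ w)
    (Submodule.sub_mem _ hz (koszulDiff_mem_koszulChains hw)) hwB fun T => by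
      rw [map_sub, koszulDiff_koszulDiff, sub_zero]
      exact hd T
  refine ⟨w + w', Submodule.add_mem _ hw hw', fun S => A.add_mem (hwA S) (hBA (hwB' S)),
    fun S => ?_⟩
  have := hwC' S
  rwa [Pi.sub_apply, sub_sub, ← Pi.add_apply, ← map_add] at this

theorem exists_homogeneous_of_mem_sup {u : MvPolynomial (Fin n) K} {e : ℕ}
    (hu : u.IsHomogeneous e) {A B : Ideal (MvPolynomial (Fin n) K)}
    (hA : A.IsHomogeneous (homogeneousSubmodule (Fin n) K))
    (hB : B.IsHomogeneous (homogeneousSubmodule (Fin n) K)) {t : ℤ} {z : MvPolynomial (Fin n) K}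
    (hz : z ∈ Ideal.span {u} * A ⊔ B) (hzt : z ∈ intGrading K n t) :
    ∃ a ∈ A, a ∈ intGrading K n (t - e) ∧ z - u * a ∈ B := by
  rcases lt_or_ge t 0 with ht | ht
  · rw [intGrading_of_neg ht, Submodule.mem_bot] at hzt
    exact ⟨0, A.zero_mem, Submodule.zero_mem _, by simp [hzt]⟩
  lift t to ℕ using ht
  rw [mem_intGrading_natCast] at hzt
  obtain ⟨y, hy, b, hb, rfl⟩ := Submodule.mem_sup.1 hz
  obtain ⟨a, ha, rfl⟩ := Ideal.mem_span_singleton_mul.1 hy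
  have hA' : ∀ k, homogeneousComponent k a ∈ A :=
    homogeneousComponent_mem_of_mem hA ha
  have hB' : ∀ k, homogeneousComponent k b ∈ B :=
    homogeneousComponent_mem_of_mem hB hb
  have hcomp : u * a + b = homogeneousComponent t (u * a) + homogeneousComponent t b := by
    rw [← map_add, homogeneousComponent_of_mem hzt, if_pos rfl]
  have hua : homogeneousComponent t (u * a) =
      if e ≤ t then u * homogeneousComponent (t - e) a else 0 := by
    have hdec : ∀ (p : MvPolynomial (Fin n) K) (k : ℕ),
        (DirectSum.decompose (homogeneousSubmodule (Fin n) K) p k : MvPolynomial (Fin n) K) =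
          homogeneousComponent k p := decomposition.decompose'_apply
    simpa only [hdec] using DirectSum.coe_decompose_mul_of_left_mem
      (homogeneousSubmodule (Fin n) K) t (b := a) hu
  rw [hcomp, hua]
  split_ifs with h
  · refine ⟨homogeneousComponent (t - e) a, hA' _, ?_, ?_⟩
    · rw [← Nat.cast_sub h, mem_intGrading_natCast]
      exact homogeneousComponent_isHomogeneous _ _
    · simpa using hB' t
  · exact ⟨0, A.zero_mem, Submodule.zero_mem _, by simpa using hB' t⟩

/-- Multiplication by `u` induces `(A / ((B : u) ⊓ A))(-e) ≅ (u A + B) / B`. Homogeneity lets chains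
be divided by `u` modulo `B` within one internal degree. -/
theorem KoszulExactAt.span_singleton_mul_sup {u : MvPolynomial (Fin n) K} {e : ℕ}
    (hu : u.IsHomogeneous e) {A B : Ideal (MvPolynomial (Fin n) K)}
    (hA : A.IsHomogeneous (homogeneousSubmodule (Fin n) K))
    (hB : B.IsHomogeneous (homogeneousSubmodule (Fin n) K)) {i : ℕ} {j : ℤ}
    (h : KoszulExactAt A (B.colon {u} ⊓ A) i (j - e)) :
    KoszulExactAt (Ideal.span {u} * A ⊔ B) B i j := by
  intro z hz hzA hd
  rw [mem_koszulChains] at hz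
  have : ∀ S : Finset (Fin n), ∃ a ∈ A,
      ((S.card = i → a ∈ intGrading K n (j - e - i)) ∧ (S.card ≠ i → a = 0)) ∧
        z S - u * a ∈ B := by
    intro S
    by_cases hS : S.card = i
    · obtain ⟨a, ha, hat, hab⟩ := exists_homogeneous_of_mem_sup hu hA hB (hzA S) (hz.1 S hS)
      exact ⟨a, ha, ⟨fun _ => by convert hat using 2; ring, fun h => absurd hS h⟩, hab⟩
    · exact ⟨0, A.zero_mem, ⟨fun h => absurd h hS, fun _ => rfl⟩, by simp [hz.2 S hS]⟩
  choose a haA hac hab using this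
  have hsmul : ∀ f : Finset (Fin n) → MvPolynomial (Fin n) K, ∀ T,
      koszulDiff K n _ (fun S => u * f S) T = u * koszulDiff K n _ f T := fun f T =>
    koszulDiff_comp (LinearMap.mulLeft (MvPolynomial (Fin n) K) u) f T
  obtain ⟨w, hw, hwA, hwB⟩ := h a (mem_koszulChains.2 ⟨fun S => (hac S).1, fun S => (hac S).2⟩)
    haA fun T => by
      refine ⟨?_, koszulDiff_mem haA T⟩
      rw [SetLike.mem_coe, Submodule.mem_colon_singleton, smul_eq_mul, mul_comm, ← hsmul]
      have h1 := koszulDiff_mem (f := z - fun S => u * a S) hab T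
      rw [map_sub, Pi.sub_apply] at h1
      simpa using B.sub_mem (hd T) h1
  rw [mem_koszulChains] at hw
  refine ⟨fun S => u * w S, mem_koszulChains.2 ⟨fun S hS => ?_, fun S hS => ?_⟩, fun S => ?_,
    fun S => ?_⟩
  · convert mul_mem_intGrading hu (hw.1 S hS) using 2
    ring
  · simp [hw.2 S hS]
  · exact Submodule.mem_sup_left (Ideal.mul_mem_mul (Ideal.mem_span_singleton_self u) (hwA S))
  · have h1 := (hwB S).1
    rw [SetLike.mem_coe, Submodule.mem_colon_singleton, smul_eq_mul, mul_comm] at h1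
    rw [hsmul]
    convert B.add_mem (hab S) h1 using 1
    ring

/-! ### Comparison with `GradedTor` and regularity -/

theorem exists_lift_koszulChains {J : Ideal (MvPolynomial (Fin n) K)} {i : ℕ} {j : ℤ}
    {f : Finset (Fin n) → MvPolynomial (Fin n) K ⧸ J}
    (hf : f ∈ koszulChains n (quotientGrading J) i j) :
    ∃ g ∈ koszulChains n (intGrading K n) i j, ∀ S, J.mkQ (g S) = f S := by
  rw [mem_koszulChains] at hf
  have : ∀ S : Finset (Fin n), ∃ a, ((S.card = i → a ∈ intGrading K n (j - i)) ∧
      (S.card ≠ i → a = 0)) ∧ J.mkQ a = f S := by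
    intro S
    by_cases hS : S.card = i
    · have h1 := hf.1 S hS
      rw [quotientGrading_eq_map] at h1
      obtain ⟨a, ha, hfa⟩ := h1
      exact ⟨a, ⟨fun _ => ha, fun h => absurd hS h⟩, hfa⟩
    · exact ⟨0, ⟨fun h => absurd h hS, fun _ => rfl⟩, by simp [hf.2 S hS]⟩
  choose g hg hgf using this
  exact ⟨g, mem_koszulChains.2 ⟨fun S => (hg S).1, fun S => (hg S).2⟩, hgf⟩

theorem mkQ_mem_koszulChains (J : Ideal (MvPolynomial (Fin n) K)) {i : ℕ} {j : ℤ}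
    {g : Finset (Fin n) → MvPolynomial (Fin n) K}
    (hg : g ∈ koszulChains n (intGrading K n) i j) :
    (fun S => J.mkQ (g S)) ∈ koszulChains n (quotientGrading J) i j := by
  rw [mem_koszulChains] at hg ⊢
  refine ⟨fun S hS => ?_, fun S hS => by rw [hg.2 S hS, map_zero]⟩
  rw [quotientGrading_eq_map]
  exact ⟨g S, hg.1 S hS, rfl⟩

theorem not_nontrivial_gradedTor_iff (J : Ideal (MvPolynomial (Fin n) K)) (i : ℕ) (j : ℤ) :
    ¬ Nontrivial (GradedTor n (quotientGrading J) i j) ↔ KoszulExactAt ⊤ J i j := by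
  rw [not_nontrivial_iff_subsingleton, Submodule.Quotient.subsingleton_iff,
    Submodule.submoduleOf, Submodule.comap_subtype_eq_top]
  constructor
  · intro h z hz _ hd
    have hcyc : (fun S => J.mkQ (z S)) ∈ koszulCycles n (quotientGrading J) i j := by
      refine ⟨mkQ_mem_koszulChains J hz, ?_⟩
      rw [SetLike.mem_coe, LinearMap.mem_ker]
      funext T
      exact (koszulDiff_comp J.mkQ z T).trans ((Submodule.Quotient.mk_eq_zero J).2 (hd T))
    obtain ⟨w', hw', hwz⟩ := h hcyc
    obtain ⟨w, hw, hww⟩ := exists_lift_koszulChains hw'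
    obtain rfl : (fun S => J.mkQ (w S)) = w' := funext hww
    refine ⟨w, hw, fun _ => Submodule.mem_top, fun S => ?_⟩
    have h1 : J.mkQ (koszulDiff K n _ w S) = J.mkQ (z S) :=
      (koszulDiff_comp J.mkQ w S).symm.trans (congrFun hwz S)
    rw [← Submodule.Quotient.mk_eq_zero J, ← Submodule.mkQ_apply, map_sub, h1, sub_self]
  · rintro h f ⟨hf, hd⟩
    obtain ⟨z, hz, hzf⟩ := exists_lift_koszulChains hf
    obtain rfl : (fun S => J.mkQ (z S)) = f := funext hzf
    obtain ⟨w, hw, -, hwz⟩ := h z hz (fun _ => Submodule.mem_top) fun T => by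
      rw [← Submodule.Quotient.mk_eq_zero J, ← Submodule.mkQ_apply, ← koszulDiff_comp]
      exact congrFun hd T
    refine ⟨_, mkQ_mem_koszulChains J hw, funext fun S => ?_⟩
    refine (koszulDiff_comp J.mkQ w S).trans ?_
    have h1 := (Submodule.Quotient.mk_eq_zero J).2 (hwz S)
    rw [← Submodule.mkQ_apply, map_sub, sub_eq_zero] at h1
    exact h1.symm

theorem regQuot_le_iff (J : Ideal (MvPolynomial (Fin n) K)) (m : EReal) :
    regQuot J ≤ m ↔ ∀ (i : ℕ) (j : ℤ), ¬ (((j - i : ℤ) : ℝ) : EReal) ≤ m →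
      KoszulExactAt ⊤ J i j := by
  simp only [regQuot, regularity, iSup_le_iff, ← not_nontrivial_gradedTor_iff]
  exact forall₂_congr fun i j => not_imp_not.symm

end Koszul

/-! ### Intersections and colons for quadratic sequences -/

section Sequences

variable {R : Type*} [CommRing R] {L : Type*} [PartialOrder L]

omit [PartialOrder L] in
theorem idealOf_le_univ (u : L → R) (S : Set L) : idealOf u S ≤ idealOf u Set.univ :=
  Ideal.span_mono (Set.image_mono (Set.subset_univ S))

theorem exists_insert_lowerSet [Finite L] (u : L → R) {S : LowerSet L} (hS : S ≠ ⊤) :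
    ∃ (l : L) (S' : LowerSet L), LiesJustAbove S l ∧ S < S' ∧
      idealOf u S' = Ideal.span {u l} ⊔ idealOf u S := by
  have hne : ((S : Set L)ᶜ).Nonempty := by
    rw [Set.nonempty_compl]
    exact fun h => hS (SetLike.coe_injective h)
  obtain ⟨l, hl⟩ := (Set.toFinite ((S : Set L)ᶜ)).exists_minimal hne
  have habove : LiesJustAbove S l := ⟨hl.1, fun m hm => by
    by_contra hmS
    exact hm.not_ge (hl.2 hmS hm.le)⟩
  refine ⟨l, ⟨insert l S, ?_⟩, habove, ?_, ?_⟩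
  · rintro a b hba (rfl | ha)
    · rcases hba.eq_or_lt with rfl | h
      · exact Set.mem_insert _ _
      · exact Set.mem_insert_of_mem _ (habove.2 b h)
    · exact Set.mem_insert_of_mem _ (S.lower hba ha)
  · exact Set.ssubset_insert hl.1
  · change idealOf u (insert l (S : Set L)) = _
    rw [idealOf, Set.image_insert_eq, Ideal.span_insert, idealOf]

theorem mem_span_singleton_sup_mul {x a : R} {I J : Ideal R}
    (h : a ∈ (Ideal.span {x} ⊔ I) * J) : ∃ c ∈ J, ∃ b ∈ I * J, a = x * c + b := by
  rw [Ideal.sup_mul] at h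
  obtain ⟨y, hy, b, hb, rfl⟩ := Submodule.mem_sup.1 h
  obtain ⟨c, hc, rfl⟩ := Ideal.mem_span_singleton_mul.1 hy
  exact ⟨c, hc, b, hb, rfl⟩

/-- Induction on `k`, and within it descending induction on `S`. Enlarging `S` by `l` writes the
element as `u l * c + b` with `b` already good; then `c` lies in `(U_S : u l) ⊓ I ≤ U_T`. The case
`k` for `T` and `u l * U_T ≤ U_S * I` finish. -/
theorem IsQuadraticSequence.idealOf_inf_pow [Finite L] {u : L → R} (hu : IsQuadraticSequence u)
    (k : ℕ) (S : LowerSet L) :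
    idealOf u S ⊓ idealOf u Set.univ ^ (k + 1) ≤ idealOf u S * idealOf u Set.univ ^ k := by
  induction k generalizing S with
  | zero => simp
  | succ k ih =>
    induction S using WellFoundedGT.induction with
    | ind S ihS =>
      by_cases hS : S = ⊤
      · subst hS
        rw [LowerSet.coe_top, ← pow_succ']
        exact inf_le_right
      obtain ⟨l, S', hl, hlt, hS'⟩ := exists_insert_lowerSet u hS
      rintro x ⟨hxS, hxI⟩
      have hx := ihS S' hlt ⟨hS' ▸ Submodule.mem_sup_right hxS, hxI⟩
      rw [hS'] at hx
      obtain ⟨c, hc, b, hb, rfl⟩ := mem_span_singleton_sup_mul hx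
      obtain ⟨T, hT, hT'⟩ := hu S l (Or.inr hl)
      have hcS : u l * c ∈ idealOf u S := by
        simpa using Ideal.sub_mem _ hxS (Ideal.mul_le_left hb)
      have hcT : c ∈ idealOf u T := hT ⟨by
        rwa [SetLike.mem_coe, Submodule.mem_colon_singleton, smul_eq_mul, mul_comm],
        Ideal.pow_le_self k.succ_ne_zero hc⟩
      refine Ideal.add_mem _ ?_ hb
      have h1 : u l * c ∈ Ideal.span {u l} * (idealOf u T * idealOf u Set.univ ^ k) :=
        Ideal.mul_mem_mul (Ideal.mem_span_singleton_self _) (ih T ⟨hcT, hc⟩)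
      rw [← mul_assoc] at h1
      rw [pow_succ', ← mul_assoc]
      exact Ideal.mul_mono_left hT' h1

/-- The stages of the filtration of `I ^ (k + 1) / I ^ (k + 2)`, where `I` is the ideal generated
by the whole sequence. -/
def powStage (u : L → R) (k : ℕ) (S : Set L) : Ideal R :=
  idealOf u S * idealOf u Set.univ ^ k ⊔ idealOf u Set.univ ^ (k + 2)

omit [PartialOrder L] in
theorem powStage_le (u : L → R) (k : ℕ) (S : Set L) :
    powStage u k S ≤ idealOf u Set.univ ^ (k + 1) := by
  refine sup_le ?_ (Ideal.pow_le_pow_right (Nat.le_succ _))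
  rw [pow_succ']
  exact Ideal.mul_mono_left (idealOf_le_univ u S)

omit [PartialOrder L] in
theorem powStage_univ (u : L → R) (k : ℕ) :
    powStage u k Set.univ = idealOf u Set.univ ^ (k + 1) := by
  refine le_antisymm (powStage_le u k _) ?_
  rw [powStage, ← pow_succ']
  exact le_sup_left

omit [PartialOrder L] in
theorem powStage_insert {u : L → R} {S S' : Set L} {l : L}
    (h : idealOf u S' = Ideal.span {u l} ⊔ idealOf u S) (k : ℕ) :
    powStage u k S' = Ideal.span {u l} * idealOf u Set.univ ^ k ⊔ powStage u k S := by
  rw [powStage, h, Ideal.sup_mul, powStage, sup_assoc]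

/-- The `I ^ (k+2)` part of `u l * x` lies in `U_S'`, hence in `U_S' * I ^ (k+1)`; its `u l`
component supplies the correction `c`. -/
theorem IsQuadraticSequence.exists_of_mul_mem_powStage [Finite L] {u : L → R}
    (hu : IsQuadraticSequence u) {S S' : LowerSet L} {l : L}
    (h : idealOf u S' = Ideal.span {u l} ⊔ idealOf u S) {k : ℕ} {x : R}
    (hx : u l * x ∈ powStage u k S) :
    ∃ c ∈ idealOf u Set.univ ^ (k + 1), u l * (x - c) ∈ idealOf u S := by
  obtain ⟨a, ha, b, hb, hab⟩ := Submodule.mem_sup.1 hx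
  have haS : a ∈ idealOf u S := Ideal.mul_le_left ha
  have hbS : b ∈ idealOf u S' := by
    have hxS' : u l * x ∈ idealOf u S' := by
      rw [h]
      exact Ideal.mem_sup_left (Ideal.mul_mem_right _ _ (Ideal.mem_span_singleton_self _))
    have haS' : a ∈ idealOf u S' := by
      rw [h]
      exact Ideal.mem_sup_right haS
    rw [← hab] at hxS'
    exact (Ideal.add_mem_iff_right _ haS').1 hxS'
  have hb' := hu.idealOf_inf_pow (k + 1) S' ⟨hbS, hb⟩
  rw [h] at hb'
  obtain ⟨c, hc, b', hb', hbc⟩ := mem_span_singleton_sup_mul hb'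
  refine ⟨c, hc, ?_⟩
  have hx' : u l * (x - c) = a + b' := by
    rw [mul_sub, ← hab, hbc]
    ring
  rw [hx']
  exact Ideal.add_mem _ haS (Ideal.mul_le_left hb')

theorem IsQuadraticSequence.colon_powStage_zero [Finite L] {u : L → R}
    (hu : IsQuadraticSequence u) {S S' : LowerSet L} {l : L}
    (h : idealOf u S' = Ideal.span {u l} ⊔ idealOf u S) :
    (powStage u 0 S).colon {u l} = (idealOf u S).colon {u l} ⊔ idealOf u Set.univ := by
  apply le_antisymm
  · intro x hx
    rw [Submodule.mem_colon_singleton, smul_eq_mul, mul_comm] at hx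
    obtain ⟨c, hc, hxc⟩ := hu.exists_of_mul_mem_powStage h hx
    rw [zero_add, pow_one] at hc
    rw [← sub_add_cancel x c]
    refine Submodule.add_mem_sup ?_ hc
    rwa [Submodule.mem_colon_singleton, smul_eq_mul, mul_comm]
  · refine sup_le (fun x hx => ?_) fun x hx => ?_
    · rw [Submodule.mem_colon_singleton] at hx ⊢
      refine Submodule.mem_sup_left ?_
      rwa [pow_zero, mul_one]
    · rw [Submodule.mem_colon_singleton]
      refine Submodule.mem_sup_right ?_
      rw [zero_add, pow_two]
      exact Ideal.mul_mem_mul hx (Ideal.subset_span ⟨l, Set.mem_univ l, rfl⟩)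

theorem IsQuadraticSequence.exists_colon_powStage_succ [Finite L] {u : L → R}
    (hu : IsQuadraticSequence u) {S S' : LowerSet L} {l : L} (hl : LiesJustAbove S l)
    (h : idealOf u S' = Ideal.span {u l} ⊔ idealOf u S) (k : ℕ) :
    ∃ T : LowerSet L, (powStage u (k + 1) S).colon {u l} ⊓ idealOf u Set.univ ^ (k + 1) =
      powStage u k T := by
  obtain ⟨T, hT, hT'⟩ := hu S l (Or.inr hl)
  refine ⟨T, le_antisymm ?_ (le_inf (sup_le (fun x hx => ?_) fun x hx => ?_) (powStage_le u k T))⟩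
  · rintro x ⟨hx, hxI⟩
    rw [SetLike.mem_coe, Submodule.mem_colon_singleton, smul_eq_mul, mul_comm] at hx
    obtain ⟨c, hc, hxc⟩ := hu.exists_of_mul_mem_powStage h hx
    have hmem : x - c ∈ idealOf u Set.univ ^ (k + 1) :=
      Ideal.sub_mem _ hxI (Ideal.pow_le_pow_right (Nat.le_succ _) hc)
    rw [← sub_add_cancel x c]
    refine Submodule.add_mem_sup (hu.idealOf_inf_pow k T ⟨hT ⟨?_,
      Ideal.pow_le_self k.succ_ne_zero hmem⟩, hmem⟩) hc
    rwa [SetLike.mem_coe, Submodule.mem_colon_singleton, smul_eq_mul, mul_comm]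
  · rw [Submodule.mem_colon_singleton, smul_eq_mul, mul_comm]
    refine Submodule.mem_sup_left ?_
    have h1 := Ideal.mul_mem_mul (Ideal.mem_span_singleton_self (u l)) hx
    rw [← mul_assoc] at h1
    rw [pow_succ', ← mul_assoc]
    exact Ideal.mul_mono_left hT' h1
  · rw [Submodule.mem_colon_singleton]
    refine Submodule.mem_sup_right ?_
    rw [pow_succ]
    exact Ideal.mul_mem_mul hx (Ideal.subset_span ⟨l, Set.mem_univ l, rfl⟩)

end Sequences

/-! ### Vanishing for the layers and for the powers -/

section Main

variable {K : Type*} [Field K] {n : ℕ} {L : Type*} [PartialOrder L]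
  {u : L → MvPolynomial (Fin n) K}

theorem isHomogeneous_totalDegree {p : MvPolynomial (Fin n) K}
    (hp : ∃ k : ℕ, p.IsHomogeneous k) : p.IsHomogeneous p.totalDegree := by
  obtain ⟨k, hk⟩ := hp
  by_cases h : p = 0
  · subst h
    exact isHomogeneous_zero _ _ _
  · rwa [hk.totalDegree h]

omit [PartialOrder L] in
theorem idealOf_isHomogeneous (hhom : ∀ l, ∃ k : ℕ, (u l).IsHomogeneous k) (S : Set L) :
    (idealOf u S).IsHomogeneous (homogeneousSubmodule (Fin n) K) := by
  refine Ideal.homogeneous_span _ _ ?_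
  rintro _ ⟨l, -, rfl⟩
  exact hhom l

omit [PartialOrder L] in
theorem idealOf_univ_pow_isHomogeneous (hhom : ∀ l, ∃ k : ℕ, (u l).IsHomogeneous k) (k : ℕ) :
    (idealOf u Set.univ ^ k).IsHomogeneous (homogeneousSubmodule (Fin n) K) := by
  induction k with
  | zero =>
    rw [pow_zero, Ideal.one_eq_top]
    exact Ideal.IsHomogeneous.top _
  | succ k ih =>
    rw [pow_succ]
    exact ih.mul (idealOf_isHomogeneous hhom _)

omit [PartialOrder L] in
theorem powStage_isHomogeneous (hhom : ∀ l, ∃ k : ℕ, (u l).IsHomogeneous k) (k : ℕ) (S : Set L) :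
    (powStage u k S).IsHomogeneous (homogeneousSubmodule (Fin n) K) :=
  ((idealOf_isHomogeneous hhom S).mul (idealOf_univ_pow_isHomogeneous hhom k)).sup
    (idealOf_univ_pow_isHomogeneous hhom (k + 2))

/-- `P` stands for "above the bound". Each induction step on `k` costs one shift by `deg (u l)`;
since `P` is upward closed, replacing that degree by `d` is harmless. -/
theorem IsQuadraticSequence.koszulExactAt_powStage [Finite L] (hu : IsQuadraticSequence u)
    (hhom : ∀ l, ∃ k : ℕ, (u l).IsHomogeneous k) {d : ℕ} (hd : ∀ l, (u l).totalDegree ≤ d)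
    {P : ℤ → Prop} (hP : Monotone P)
    (h0 : ∀ (S : LowerSet L) (l : L), LiesInsideOrJustAbove S l → ∀ (i : ℕ) (j : ℤ), P (j - i) →
      KoszulExactAt ⊤ ((idealOf u S).colon {u l} ⊔ idealOf u Set.univ) i j)
    (k : ℕ) (S : LowerSet L) (i : ℕ) (j : ℤ) (hj : P (j - i - (k + 1) * d)) :
    KoszulExactAt (idealOf u Set.univ ^ (k + 1)) (powStage u k S) i j := by
  induction k generalizing S i j with
  | zero =>
    induction S using WellFoundedGT.induction with
    | ind S ihS =>
      by_cases hS : S = ⊤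
      · rw [hS, LowerSet.coe_top, powStage_univ]
        exact .refl _ i j
      obtain ⟨l, S', hl, hlt, hS'⟩ := exists_insert_lowerSet u hS
      have hle : powStage u 0 S ≤ powStage u 0 S' := by
        rw [powStage_insert hS']
        exact le_sup_right
      refine (ihS S' hlt).trans (powStage_le u 0 S') hle ?_
      rw [powStage_insert hS']
      refine .span_singleton_mul_sup (isHomogeneous_totalDegree (hhom l))
        (idealOf_univ_pow_isHomogeneous hhom 0) (powStage_isHomogeneous hhom 0 S) ?_
      rw [hu.colon_powStage_zero hS', pow_zero, Ideal.one_eq_top, inf_top_eq]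
      refine h0 S l (Or.inr hl) i _ (hP ?_ hj)
      have := hd l
      push_cast
      linarith [(Nat.cast_le (α := ℤ)).2 this]
  | succ k ih =>
    induction S using WellFoundedGT.induction with
    | ind S ihS =>
      by_cases hS : S = ⊤
      · rw [hS, LowerSet.coe_top, powStage_univ]
        exact .refl _ i j
      obtain ⟨l, S', hl, hlt, hS'⟩ := exists_insert_lowerSet u hS
      have hle : powStage u (k + 1) S ≤ powStage u (k + 1) S' := by
        rw [powStage_insert hS']
        exact le_sup_right
      refine (ihS S' hlt).trans (powStage_le u (k + 1) S') hle ?_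
      rw [powStage_insert hS']
      refine .span_singleton_mul_sup (isHomogeneous_totalDegree (hhom l))
        (idealOf_univ_pow_isHomogeneous hhom (k + 1)) (powStage_isHomogeneous hhom (k + 1) S) ?_
      obtain ⟨T, hT⟩ := hu.exists_colon_powStage_succ hl hS' k
      rw [hT]
      refine ih T i _ (hP ?_ hj)
      have := hd l
      push_cast
      linarith [(Nat.cast_le (α := ℤ)).2 this]

/-- Makes `R / I` itself one of the quotients in the maximum: take `l` minimal with `u l ≠ 0`, so
everything below it vanishes and `R` being a domain kills the colon. -/
theorem exists_colon_eq_bot [Finite L] (hne : ∃ l, u l ≠ 0) :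
    ∃ (S : LowerSet L) (l : L), LiesInsideOrJustAbove S l ∧ (idealOf u S).colon {u l} = ⊥ := by
  obtain ⟨l, hl⟩ := (Set.toFinite {l | u l ≠ 0}).exists_minimal hne
  have hS : idealOf u (LowerSet.Iio l) = ⊥ := by
    rw [idealOf, Ideal.span_eq_bot]
    rintro _ ⟨m, hm, rfl⟩
    by_contra h
    exact (show m < l from hm).not_ge (hl.2 h (show m < l from hm).le)
  refine ⟨LowerSet.Iio l, l, Or.inr ⟨fun h => lt_irrefl l h, fun m hm => hm⟩, ?_⟩
  rw [eq_bot_iff, hS]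
  intro x hx
  rw [Submodule.mem_colon_singleton, Submodule.mem_bot, smul_eq_mul] at hx
  exact (mul_eq_zero.1 hx).resolve_right hl.1

theorem IsQuadraticSequence.koszulExactAt_pow [Finite L] (hu : IsQuadraticSequence u)
    (hhom : ∀ l, ∃ k : ℕ, (u l).IsHomogeneous k) (hne : ∃ l, u l ≠ 0) {d : ℕ}
    (hd : ∀ l, (u l).totalDegree ≤ d) {P : ℤ → Prop} (hP : Monotone P)
    (h0 : ∀ (S : LowerSet L) (l : L), LiesInsideOrJustAbove S l → ∀ (i : ℕ) (j : ℤ), P (j - i) →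
      KoszulExactAt ⊤ ((idealOf u S).colon {u l} ⊔ idealOf u Set.univ) i j)
    (k : ℕ) (i : ℕ) (j : ℤ) (hj : P (j - i - k * d)) :
    KoszulExactAt ⊤ (idealOf u Set.univ ^ (k + 1)) i j := by
  induction k with
  | zero =>
    obtain ⟨S, l, hl, hS⟩ := exists_colon_eq_bot hne
    have := h0 S l hl i j (by simpa using hj)
    rwa [hS, bot_sup_eq, ← pow_one (idealOf u Set.univ)] at this
  | succ k ih =>
    refine (ih (hP ?_ hj)).trans le_top (Ideal.pow_le_pow_right (Nat.le_succ _)) ?_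
    · push_cast
      linarith [(Nat.cast_nonneg d : (0 : ℤ) ≤ d)]
    -- For the empty poset ideal the stage is `I ^ (k+2)`, so this is the whole layer.
    · have := hu.koszulExactAt_powStage hhom hd hP h0 k ⊥ i j (by exact_mod_cast hj)
      have hbot : idealOf u (∅ : Set L) = ⊥ := by rw [idealOf, Set.image_empty, Ideal.span_empty]
      rwa [powStage, LowerSet.coe_bot, hbot, Submodule.bot_mul, bot_sup_eq] at this

end Main

end QuadraticSequence

theorem mainTheorem1 {K : Type*} [Field K] {n : ℕ} {L : Type*} [Fintype L] [PartialOrder L]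
    (u : L → MvPolynomial (Fin n) K)
    (hhom : ∀ l, ∃ k : ℕ, (u l).IsHomogeneous k)
    (hne : ∃ l, u l ≠ 0)
    (hquad : QuadraticSequence.IsQuadraticSequence u)
    (s : ℕ) (hs : 1 ≤ s) :
    QuadraticSequence.regQuot (QuadraticSequence.idealOf u Set.univ ^ s) ≤
      (((Finset.univ.sup fun l => (u l).totalDegree) * (s - 1) : ℕ) : EReal) +
        ⨆ (S : LowerSet L) (l : L) (_ : QuadraticSequence.LiesInsideOrJustAbove S l),
          QuadraticSequence.regQuot
            ((QuadraticSequence.idealOf u S).colon {u l} ⊔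
              QuadraticSequence.idealOf u Set.univ) := by
  obtain ⟨k, rfl⟩ := Nat.exists_eq_add_of_le' hs
  set d := Finset.univ.sup fun l => (u l).totalDegree
  set m := ⨆ (S : LowerSet L) (l : L) (_ : QuadraticSequence.LiesInsideOrJustAbove S l),
    QuadraticSequence.regQuot
      ((QuadraticSequence.idealOf u S).colon {u l} ⊔ QuadraticSequence.idealOf u Set.univ) with hm
  rw [QuadraticSequence.regQuot_le_iff]
  intro i j hj
  refine hquad.koszulExactAt_pow hhom hne (d := d)
    (fun l => Finset.le_sup (f := fun l => (u l).totalDegree) (Finset.mem_univ l))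
    -- Working with the negated inequality avoids subtracting in `EReal`, where `m` may be infinite.
    (P := fun t => ¬ ((t : ℝ) : EReal) ≤ m) ?_ ?_ k i j ?_
  · intro a b hab ha hb
    exact ha (le_trans (EReal.coe_le_coe_iff.2 (Int.cast_le.2 hab)) hb)
  · intro S l hl
    refine (QuadraticSequence.regQuot_le_iff _ m).1 ?_
    exact le_iSup_of_le S (le_iSup_of_le l (le_iSup_of_le hl le_rfl))
  · intro h
    refine hj (le_trans (le_of_eq ?_) (add_le_add_right h _))
    rw [show ((d * (k + 1 - 1) : ℕ) : EReal) = (((d * k : ℕ) : ℝ) : EReal) by simp,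
      ← EReal.coe_add]
    congr 1
    push_cast
    ring
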